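/- Let $\mathbf K$ be the quaternions $\mathbf H$ ($m=3$) or the octonions $\mathbf O$ ($m=7$), with standard generators $i_0=1,i_1,\dots,i_m$ and conjugation $z\mapsto\tilde z$. A *Banach algebra over $\mathbf K$* is a complete normed, not necessarily associative, ring $\mathcal A$ with unit $e$, with real bilinear product, $|e|=1$ and $|xy|\le|x||y|$, which is also a two-sided $\mathbf K$-vector space (the scalar products are distributive and alternative, and associative if $\mathbf K=\mathbf H$; left and right real scalars act as the real vector space structure) with $|ax|=|xa|=|a||x|$ for $a\in\mathbf K$, $x\in\mathcal A$. A *$C^*$-algebra over $\mathbf K$* is a Banach algebra over $\mathbf K$ with an additive involution $*$ such that $(xy)^*=y^*x^*$, $(ax)^*=x^*\tilde a$ and $|x^*x|=|x|^2$ for all $x,y\in\mathcal A$, $a\in\mathbf K$. It is *quasicommutative* if there is a commutative (associative, unital) real algebra $\mathcal A_0$ such that $\mathcal A$ is isomorphic, as an algebra over $\mathbf K$ with involution, to $\mathcal A_0i_0\oplus\mathcal A_0i_1\oplus\dots\oplus\mathcal A_0i_m=\mathcal A_0\otimes_{\mathbf R}\mathbf K$, with the product $(az)(bw)=(ab)(zw)$,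 with $\mathbf K$ acting by $c(az)=a(cz)$ and $(az)c=a(zc)$, and with the involution $(a\,i_0)^*=a\,i_0$, $(a\,i_p)^*=-a\,i_p$ for $p\ge1$ ($a,b\in\mathcal A_0$, $z,w,c\in\mathbf K$). **Theorem.** Let $\mathcal A$ be a quasicommutative $C^*$-algebra over $\mathbf K$ and let $\Lambda$ be its spectrum: the set of all maximal ideals of $\mathcal A$ (maximal among the proper two-sided ideals that are closed under multiplication by $\mathbf K$ on both sides). Then for every $x\in\mathcal A$ and $M\in\Lambda$ there is a unique $x(M)\in\mathbf K$ with $x-x(M)e\in M$. With the weakest topology on $\Lambda$ for which all functions $M\mapsto x(M)$ are continuous, $\Lambda$ is a compact Hausdorff space, and the map sending $x$ to the function $M\mapsto x(M)$ is an isometric $*$-isomorphism of algebras over $\mathbf K$ from $\mathcal A$ onto the algebra $C(\Lambda,\mathbf K)$ of all continuous functions $\Lambda\to\mathbf K$, with pointwise operations, pointwise conjugation as involution, and the supremum norm. -/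

import Mathlib

open scoped Quaternion

noncomputable section

/-! ### The octonions, by doubling the quaternions -/

/-- The octonions `a + b l` with `a`, `b` real quaternions, with the Euclidean norm of `ℝ⁸`. -/
def Octonion : Type := WithLp 2 (ℍ[ℝ] × ℍ[ℝ])

namespace Octonion

instance : NormedAddCommGroup Octonion := inferInstanceAs (NormedAddCommGroup (WithLp 2 (ℍ[ℝ] × ℍ[ℝ])))

instance : NormedSpace ℝ Octonion := inferInstanceAs (NormedSpace ℝ (WithLp 2 (ℍ[ℝ] × ℍ[ℝ])))

/-- The octonion `a + b l`. -/
def mk (a b : ℍ[ℝ]) : Octonion := WithLp.toLp 2 (a, b)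

/-- The component `a` of `a + b l`. -/
def fst (x : Octonion) : ℍ[ℝ] := (WithLp.ofLp x).1

/-- The component `b` of `a + b l`. -/
def snd (x : Octonion) : ℍ[ℝ] := (WithLp.ofLp x).2

theorem ext {x y : Octonion} (h₁ : x.fst = y.fst) (h₂ : x.snd = y.snd) : x = y :=
  (WithLp.ofLp_injective 2) (Prod.ext h₁ h₂)

@[simp] theorem fst_mk (a b : ℍ[ℝ]) : (mk a b).fst = a := rfl
@[simp] theorem snd_mk (a b : ℍ[ℝ]) : (mk a b).snd = b := rfl
@[simp] theorem fst_add (x y : Octonion) : (x + y).fst = x.fst + y.fst := rfl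
@[simp] theorem snd_add (x y : Octonion) : (x + y).snd = x.snd + y.snd := rfl
@[simp] theorem fst_zero : (0 : Octonion).fst = 0 := rfl
@[simp] theorem snd_zero : (0 : Octonion).snd = 0 := rfl

/-- `(a + b l)(c + d l) = (a c - d̃ b) + (d a + b c̃) l`. -/
instance : Mul Octonion :=
  ⟨fun x y => mk (x.fst * y.fst - star y.snd * x.snd) (y.snd * x.fst + x.snd * star y.fst)⟩

instance : One Octonion := ⟨mk 1 0⟩

/-- The conjugation `a + b l ↦ ã - b l`. -/
instance : Star Octonion := ⟨fun x => mk (star x.fst) (-x.snd)⟩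

@[simp] theorem fst_mul (x y : Octonion) :
    (x * y).fst = x.fst * y.fst - star y.snd * x.snd := rfl
@[simp] theorem snd_mul (x y : Octonion) :
    (x * y).snd = y.snd * x.fst + x.snd * star y.fst := rfl
@[simp] theorem fst_one : (1 : Octonion).fst = 1 := rfl
@[simp] theorem snd_one : (1 : Octonion).snd = 0 := rfl
@[simp] theorem fst_star (x : Octonion) : (star x).fst = star x.fst := rfl
@[simp] theorem snd_star (x : Octonion) : (star x).snd = -x.snd := rfl

instance : NonAssocRing Octonion :=
  { (inferInstance : AddCommGroup Octonion) with
    mul := (· * ·)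
    one := 1
    left_distrib := fun x y z => by
      apply ext <;> simp [mul_add, add_mul] <;> abel
    right_distrib := fun x y z => by
      apply ext <;> simp [mul_add, add_mul] <;> abel
    zero_mul := fun x => by apply ext <;> simp
    mul_zero := fun x => by apply ext <;> simp
    one_mul := fun x => by apply ext <;> simp
    mul_one := fun x => by apply ext <;> simp }

end Octonion

/-- The quaternion `a + b i + c j + d k`. -/
def quat (a b c d : ℝ) : ℍ[ℝ] := ⟨a, b, c, d⟩

@[simp] theorem quat_re (a b c d : ℝ) : (quat a b c d).re = a := rfl
@[simp] theorem quat_imI (a b c d : ℝ) : (quat a b c d).imI = b := rfl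
@[simp] theorem quat_imJ (a b c d : ℝ) : (quat a b c d).imJ = c := rfl
@[simp] theorem quat_imK (a b c d : ℝ) : (quat a b c d).imK = d := rfl

/-- The standard generators `1, i, j, k` of the quaternions. -/
def quaternionGenerators : Fin 4 → ℍ[ℝ] :=
  ![quat 1 0 0 0, quat 0 1 0 0, quat 0 0 1 0, quat 0 0 0 1]

/-- The standard generators `1, i, j, k, l, i l, j l, k l` of the octonions. -/
def octonionGenerators : Fin 8 → Octonion :=
  ![Octonion.mk (quat 1 0 0 0) 0, Octonion.mk (quat 0 1 0 0) 0,
    Octonion.mk (quat 0 0 1 0) 0, Octonion.mk (quat 0 0 0 1) 0,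
    Octonion.mk 0 (quat 1 0 0 0), Octonion.mk 0 (quat 0 1 0 0),
    Octonion.mk 0 (quat 0 0 1 0), Octonion.mk 0 (quat 0 0 0 1)]

/-! ### Banach algebras and C*-algebras over `K`

Below `K` stands for the quaternions or the octonions. The left product of a vector `x` by a
scalar `c : K` is `c • x`, the right product is `MulOpposite.op c • x`. -/

/-- A ring with unit, not necessarily associative, with a submultiplicative norm for which the
unit has norm one. -/
class NonAssocUnitalNormedRing (A : Type*) extends NonAssocRing A, NormedAddCommGroup A where
  norm_one_eq : ‖(1 : A)‖ = 1
  norm_mul_le_mul : ∀ x y : A, ‖x * y‖ ≤ ‖x‖ * ‖y‖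

/-- `A` is a Banach algebra over `K`: a complete normed ring with unit that is a two-sided vector
space over `K`. The scalar products are distributive and alternative, and associative if `K` is.
The two-sided products by real scalars agree with the real vector space structure, and the ring
product is real bilinear. -/
structure IsBanachAlgebraOver (K A : Type*) [NonAssocRing K] [Module ℝ K] [Norm K]
    [NonAssocUnitalNormedRing A] [NormedSpace ℝ A] [SMul K A] [SMul Kᵐᵒᵖ A] : Prop where
  complete : CompleteSpace A
  smul_add : ∀ (a : K) (x y : A), a • (x + y) = a • x + a • y
  add_smul : ∀ (a b : K) (x : A), (a + b) • x = a • x + b • x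
  smul_smul_self : ∀ (a : K) (x : A), a • (a • x) = (a * a) • x
  smul_smul_of_assoc : (∀ a b c : K, a * b * c = a * (b * c)) →
    ∀ (a b : K) (x : A), a • (b • x) = (a * b) • x
  op_smul_add : ∀ (a : K) (x y : A),
    MulOpposite.op a • (x + y) = MulOpposite.op a • x + MulOpposite.op a • y
  add_op_smul : ∀ (a b : K) (x : A),
    MulOpposite.op (a + b) • x = MulOpposite.op a • x + MulOpposite.op b • x
  op_smul_op_smul_self : ∀ (a : K) (x : A),
    MulOpposite.op a • (MulOpposite.op a • x) = MulOpposite.op (a * a) • x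
  op_smul_op_smul_of_assoc : (∀ a b c : K, a * b * c = a * (b * c)) →
    ∀ (a b : K) (x : A),
      MulOpposite.op a • (MulOpposite.op b • x) = MulOpposite.op (b * a) • x
  norm_smul_eq : ∀ (a : K) (x : A), ‖a • x‖ = ‖a‖ * ‖x‖
  norm_op_smul_eq : ∀ (a : K) (x : A), ‖MulOpposite.op a • x‖ = ‖a‖ * ‖x‖
  real_smul : ∀ (r : ℝ) (x : A), (r • (1 : K)) • x = r • x
  real_op_smul : ∀ (r : ℝ) (x : A), MulOpposite.op (r • (1 : K)) • x = r • x
  real_smul_mul : ∀ (r : ℝ) (x y : A), (r • x) * y = r • (x * y)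
  mul_real_smul : ∀ (r : ℝ) (x y : A), x * (r • y) = r • (x * y)

/-- `A` is a C*-algebra over `K`: a Banach algebra over `K` with an involution such that
`(c x)* = x* c̃` and `‖x* x‖ = ‖x‖²`. -/
structure IsCStarAlgebraOver (K A : Type*) [NonAssocRing K] [Module ℝ K] [Norm K] [Star K]
    [NonAssocUnitalNormedRing A] [NormedSpace ℝ A] [SMul K A] [SMul Kᵐᵒᵖ A] [Star A] : Prop
    extends IsBanachAlgebraOver K A where
  star_star_eq : ∀ x : A, star (star x) = x
  star_add_eq : ∀ x y : A, star (x + y) = star x + star y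
  star_mul_eq : ∀ x y : A, star (x * y) = star y * star x
  star_smul_eq : ∀ (a : K) (x : A), star (a • x) = MulOpposite.op (star a) • star x
  norm_star_mul_self_eq : ∀ x : A, ‖star x * x‖ = ‖x‖ ^ 2

/-- An isomorphism of algebras over `K` between `A₀ i₀ ⊕ A₀ i₁ ⊕ ⋯ ⊕ A₀ iₘ` and `A`, for a
commutative real algebra `A₀`. Here `term a z` is the image of `a z`; the product of the
direct sum is `(a z) (b w) = (a b) (z w)`, and `K` acts on both sides through the
factor `z`. -/
structure QuasicommutativeDecomposition {K : Type*} [NonAssocRing K] [Module ℝ K]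
    {ι : Type*} [Fintype ι] (i : ι → K) (A₀ : Type*) [CommRing A₀] [Algebra ℝ A₀]
    (A : Type*) [NonAssocUnitalNormedRing A] [NormedSpace ℝ A] [SMul K A] [SMul Kᵐᵒᵖ A] where
  term : A₀ →ₗ[ℝ] K →ₗ[ℝ] A
  bijective : Function.Bijective fun x : ι → A₀ => ∑ p, term (x p) (i p)
  term_one_one : term 1 1 = 1
  term_mul_term : ∀ (a b : A₀) (z w : K), term a z * term b w = term (a * b) (z * w)
  smul_term : ∀ (c : K) (a : A₀) (z : K), c • term a z = term a (c * z)
  op_smul_term : ∀ (c : K) (a : A₀) (z : K), MulOpposite.op c • term a z = term a (z * c)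

/-- `A` is a quasicommutative C*-algebra over `K`, where `i` is the family of standard generators
of `K`: a C*-algebra over `K` that is isomorphic to `A₀ i₀ ⊕ ⋯ ⊕ A₀ iₘ` for some commutative real
algebra `A₀`, the involution being `(a iₚ)* = a ĩₚ` (which is `a i₀` for `p = 0` and `-(a iₚ)`
otherwise). -/
def IsQuasicommutativeCStarAlgebra.{u} {K : Type*} [NonAssocRing K] [Module ℝ K] [Norm K] [Star K]
    {ι : Type*} [Fintype ι] (i : ι → K) (A : Type u) [NonAssocUnitalNormedRing A]
    [NormedSpace ℝ A] [SMul K A] [SMul Kᵐᵒᵖ A] [Star A] : Prop :=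
  IsCStarAlgebraOver K A ∧
    ∃ (A₀ : Type u) (_ : CommRing A₀) (_ : Algebra ℝ A₀)
      (D : QuasicommutativeDecomposition i A₀ A),
      ∀ (a : A₀) (p : ι), star (D.term a (i p)) = D.term a (star (i p))

/-! ### The spectrum -/

/-- `I` is a two-sided ideal over `K` in `A`. -/
structure IsIdealOver (K : Type*) {A : Type*} [NonAssocUnitalNormedRing A] [SMul K A]
    [SMul Kᵐᵒᵖ A] (I : AddSubgroup A) : Prop where
  mul_mem_left : ∀ (a x : A), x ∈ I → a * x ∈ I
  mul_mem_right : ∀ (a x : A), x ∈ I → x * a ∈ I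
  smul_mem : ∀ (c : K) (x : A), x ∈ I → c • x ∈ I
  op_smul_mem : ∀ (c : K) (x : A), x ∈ I → MulOpposite.op c • x ∈ I

/-- `I` is maximal among the proper two-sided ideals over `K` in `A`. -/
def IsMaximalIdealOver (K : Type*) {A : Type*} [NonAssocUnitalNormedRing A] [SMul K A]
    [SMul Kᵐᵒᵖ A] (I : AddSubgroup A) : Prop :=
  IsIdealOver K I ∧ I ≠ ⊤ ∧ ∀ J : AddSubgroup A, IsIdealOver K J → I ≤ J → J ≠ ⊤ → J = I

/-- The spectrum (structural space) of `A`: the set of its maximal ideals. -/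
def MaximalIdealSpace (K A : Type*) [NonAssocUnitalNormedRing A] [SMul K A]
    [SMul Kᵐᵒᵖ A] : Type _ :=
  {I : AddSubgroup A // IsMaximalIdealOver K I}

open Classical in
/-- The value `x(M)` of `x` at the maximal ideal `M`: the scalar `c` with `x + M = c e + M`
(zero if there is none). -/
def gelfandValue {K A : Type*} [NonAssocRing K] [NonAssocUnitalNormedRing A] [SMul K A]
    [SMul Kᵐᵒᵖ A] (M : MaximalIdealSpace K A) (x : A) : K :=
  if h : ∃ c : K, x - c • (1 : A) ∈ M.1 then h.choose else 0

/-- The Gelfand topology: the weakest one for which all functions `M ↦ x(M)` are continuous. -/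
instance {K A : Type*} [NonAssocRing K] [TopologicalSpace K] [NonAssocUnitalNormedRing A]
    [SMul K A] [SMul Kᵐᵒᵖ A] : TopologicalSpace (MaximalIdealSpace K A) :=
  ⨅ x : A, TopologicalSpace.induced (fun M => gelfandValue M x) inferInstance

/-- `Φ` is an isometric *-isomorphism of algebras over `K` from `A` onto the algebra `C(Λ, K)` with
pointwise operations, pointwise conjugation and the supremum norm. -/
structure IsIsometricStarIsomorphism {K A Λ : Type*} [NonAssocRing K] [TopologicalSpace K]
    [Norm K] [Star K] [TopologicalSpace Λ] [NonAssocUnitalNormedRing A] [SMul K A] [SMul Kᵐᵒᵖ A]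
    [Star A] (Φ : A ≃ C(Λ, K)) : Prop where
  map_add : ∀ (x y : A) (t : Λ), Φ (x + y) t = Φ x t + Φ y t
  map_mul : ∀ (x y : A) (t : Λ), Φ (x * y) t = Φ x t * Φ y t
  map_one : ∀ t : Λ, Φ 1 t = 1
  map_smul : ∀ (c : K) (x : A) (t : Λ), Φ (c • x) t = c * Φ x t
  map_op_smul : ∀ (c : K) (x : A) (t : Λ), Φ (MulOpposite.op c • x) t = Φ x t * c
  map_star : ∀ (x : A) (t : Λ), Φ (star x) t = star (Φ x t)
  norm_isLUB : ∀ x : A, IsLUB (Set.range fun t : Λ => ‖Φ x t‖) ‖x‖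

end

/-!
Write the algebra as `A = A₀ i₀ ⊕ ⋯ ⊕ A₀ iₘ`. The subalgebra
`A₀ i₀ ⊕ A₀ i₁` is a commutative complex C*-algebra: it is
associative, since it is the complexification of `A₀`, and it is closed in `A`, since `(x + x*) / 2`
is the component of `x` in `A₀ i₀`. Complex Gelfand duality identifies it with `C(X, ℂ)`, and hence
`A₀`, the set of fixed points of the involution, with `C(X, ℝ)`
(`exists_algEquiv_continuousMap_real`).

Evaluating coefficients at the points of `X` then identifies `A` with `C(X, K)`. The norms agree
because `‖x‖² = ‖x* x‖` and `x* x = ∑ aₚ²` is in `A₀`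
(`QuasicommutativeDecomposition.isLUB_norm_evalAt`).

It remains to see that the spectrum of `C(X, K)` is `X`. An ideal contains `|x|² = x* x` along with
`x`, so a proper ideal has a common zero because its real-valued members do
(`IsIsometricStarIsomorphism.exists_ideal_le_ker_evalHom`). Therefore the maximal ideals are those
of the functions that vanish at a given point, `x(M)` is the value of `x` at this point, and the
bijection from the compact space `X` to the spectrum is a homeomorphism because it is continuous and
the Gelfand topology is Hausdorff. The two cases of the theorem differ only in the verification of
`IsGeneratorSystem`.
-/

/-! ### The complexification of a commutative real algebra -/

noncomputable section

/-- The complexification `A₀ ⊕ A₀ ω`, `ω² = -1`, of a commutative real algebra `A₀`. -/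
abbrev Complexification (A₀ : Type*) [CommRing A₀] : Type _ := QuadraticAlgebra A₀ (-1) 0

namespace Complexification

variable {A₀ : Type*} [CommRing A₀] [Algebra ℝ A₀]

/-- The complex scalar `r + s i` acts as multiplication by `r + s ω`. -/
instance : Algebra ℂ (Complexification A₀) :=
  RingHom.toAlgebra
    { toFun := fun c => ⟨algebraMap ℝ A₀ c.re, algebraMap ℝ A₀ c.im⟩
      map_one' := by
        rw [← QuadraticAlgebra.C_one]
        ext <;> simp [QuadraticAlgebra.C]
      map_zero' := by ext <;> simp
      map_add' := fun c d => by ext <;> simp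
      map_mul' := fun c d => by
        ext
        · simp
          ring
        · simp }

theorem smul_def (c : ℂ) (x : Complexification A₀) :
    c • x = ⟨c.re • x.re - c.im • x.im, c.re • x.im + c.im • x.re⟩ := by
  have h : c • x = (⟨algebraMap ℝ A₀ c.re, algebraMap ℝ A₀ c.im⟩ : Complexification A₀) * x := rfl
  rw [h]
  ext <;> simp [Algebra.smul_def]
  ring

instance : StarModule ℂ (Complexification A₀) where
  star_smul c x := by
    rw [smul_def, smul_def]
    ext <;> simp
    ring

theorem C_algebraMap (r : ℝ) :
    (.C (algebraMap ℝ A₀ r) : Complexification A₀) = (r : ℂ) • (1 : Complexification A₀) := by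
  rw [smul_def, ← QuadraticAlgebra.C_one]
  ext <;> simp [QuadraticAlgebra.C, Algebra.smul_def]

end Complexification

open Complexification in
/-- Suppose that an embedding `f` with complete range turns the complexification of `A₀` into a
complex C*-algebra for the norm `‖f x‖`. Then `A₀` is the algebra of all real continuous functions
on a compact Hausdorff space: under complex Gelfand duality it corresponds to the fixed points of the
involution, that is, to the real-valued functions. -/
theorem exists_algEquiv_continuousMap_real.{u, v} {A₀ : Type u} [CommRing A₀] [Algebra ℝ A₀]
    {E : Type v} [NormedAddCommGroup E] (f : Complexification A₀ →+ E)
    (hinj : Function.Injective f) (hcomp : IsComplete (Set.range f))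
    (hmul : ∀ x y, ‖f (x * y)‖ ≤ ‖f x‖ * ‖f y‖) (hsmul : ∀ (c : ℂ) x, ‖f (c • x)‖ = ‖c‖ * ‖f x‖)
    (hstar : ∀ x, ‖f (star x * x)‖ = ‖f x‖ ^ 2) :
    ∃ (X : Type u) (_ : TopologicalSpace X) (_ : CompactSpace X) (_ : T2Space X)
      (e : A₀ ≃ₐ[ℝ] C(X, ℝ)), ∀ a : A₀, ‖e a‖ = ‖f ⟨a, 0⟩‖ := by
  let B := Complexification A₀
  let nacg : NormedAddCommGroup B := NormedAddCommGroup.induced B E f hinj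
  let : NormedCommRing B :=
    { (inferInstance : CommRing B), nacg with
      norm_mul_le := hmul }
  have hiso : Isometry (f : B → E) := AddMonoidHomClass.isometry_of_norm f fun x => rfl
  let : CommCStarAlgebra B :=
    { (inferInstance : NormedCommRing B), (inferInstance : StarRing B),
      (inferInstance : Algebra ℂ B) with
      norm_smul_le := fun c x => (hsmul c x).le
      complete := (completeSpace_iff_isComplete_range hiso.isUniformInducing).2 hcomp |>.complete
      norm_mul_self_le := fun x => by
        have := hstar x
        change ‖f x‖ * ‖f x‖ ≤ ‖f (star x * x)‖
        rw [this, sq]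
      star_smul := star_smul }
  let X := WeakDual.characterSpace ℂ B
  let Γ : B ≃⋆ₐ[ℂ] C(X, ℂ) := gelfandStarTransform B
  have hΓ : ∀ b : B, ‖Γ b‖ = ‖f b‖ := fun b =>
    (AddMonoidHomClass.isometry_iff_norm (WeakDual.gelfandTransform ℂ B)).1
      (gelfandTransform_isometry B) b
  -- The elements of `A₀` are fixed by the involution, so their transforms are real-valued.
  have hreal : ∀ (a : A₀) (t : X), Γ (.C a) t = ((Γ (.C a) t).re : ℂ) := fun a t => by
    have h : star (.C a : B) = .C a := by ext <;> simp [QuadraticAlgebra.C]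
    have h' := DFunLike.congr_fun (map_star Γ (.C a)) t
    rw [h] at h'
    exact (Complex.conj_eq_iff_re.1 h'.symm).symm
  let g : A₀ →ₐ[ℝ] C(X, ℝ) :=
    { toFun := fun a => ⟨fun t => (Γ (.C a) t).re, by fun_prop⟩
      map_one' := by ext t; simp [QuadraticAlgebra.C_one]
      map_zero' := by ext t; simp [QuadraticAlgebra.C_zero]
      map_add' := fun a b => by ext t; simp [QuadraticAlgebra.C_add]
      map_mul' := fun a b => by
        ext t
        simp only [ContinuousMap.coe_mk, ContinuousMap.mul_apply]
        rw [QuadraticAlgebra.C_mul, map_mul, ContinuousMap.mul_apply, hreal a t, hreal b t,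
          ← Complex.ofReal_mul]
        simp only [Complex.ofReal_re]
      commutes' := fun r => by
        ext t
        have h : (.C (algebraMap ℝ A₀ r) : B) = (r : ℂ) • (1 : B) := C_algebraMap r
        simp only [ContinuousMap.coe_mk, h, map_smul, map_one]
        simp }
  have hnorm : ∀ a, ‖g a‖ = ‖f ⟨a, 0⟩‖ := fun a => by
    rw [← show ‖Γ (.C a)‖ = ‖f ⟨a, 0⟩‖ from hΓ _]
    refine le_antisymm ?_ ?_
    · refine (ContinuousMap.norm_le _ (norm_nonneg _)).2 fun t => ?_
      exact (Complex.abs_re_le_norm _).trans (ContinuousMap.norm_coe_le_norm (Γ (.C a)) t)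
    · refine (ContinuousMap.norm_le _ (norm_nonneg _)).2 fun t => ?_
      rw [hreal a t, Complex.norm_real]
      exact ContinuousMap.norm_coe_le_norm (g a) t
  have hg : Function.Bijective g := by
    refine ⟨(injective_iff_map_eq_zero g).2 fun a ha => ?_, fun h => ?_⟩
    · have h0 : f ⟨a, 0⟩ = 0 := by rw [← norm_eq_zero, ← hnorm, ha, norm_zero]
      have h1 : (⟨a, 0⟩ : B) = 0 := hinj (h0.trans (map_zero f).symm)
      exact congrArg QuadraticAlgebra.re h1
    · let H : C(X, ℂ) := ⟨fun t => (h t : ℂ), by fun_prop⟩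
      have hH : star H = H := by ext t; simp [H]
      obtain ⟨b, hb⟩ := EquivLike.surjective Γ H
      have hsb : star b = b := by
        apply EquivLike.injective Γ
        rw [map_star, hb, hH]
      have him : b.im = 0 := by
        have h1 : -b.im = b.im := congrArg QuadraticAlgebra.im hsb
        have h2 : (2 : ℝ) • b.im = 0 := by
          rw [two_smul]
          nth_rw 1 [← h1]
          simp
        simpa using h2
      refine ⟨b.re, ?_⟩
      have h3 : .C b.re = b := by ext <;> simp [QuadraticAlgebra.C, him]
      ext t
      change (Γ (.C b.re) t).re = h t
      rw [h3, show Γ b = H from hb]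
      rfl
  exact ⟨X, inferInstance, inferInstance, inferInstance, AlgEquiv.ofBijective g hg, hnorm⟩

/-! ### The quaternions and the octonions -/

/-- The properties of `K` (the quaternions or the octonions), its standard generators `i p` and the
coordinates `coord p` with respect to them that the duality depends on. The index `o` is that of the
unit, and `j` that of some imaginary generator; `i j` serves as the imaginary unit of the complex
subalgebra to which complex Gelfand duality is applied. Neither associativity nor alternativity of
`K` is needed. -/
structure IsGeneratorSystem {K : Type*} [NonAssocRing K] [Module ℝ K] [Norm K] [Star K]
    [TopologicalSpace K] {ι : Type*} [Fintype ι] [DecidableEq ι] (i : ι → K) (o j : ι)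
    (coord : ι → K →ₗ[ℝ] ℝ) : Prop where
  smul_mul : ∀ (r : ℝ) (z w : K), (r • z) * w = r • (z * w)
  mul_smul : ∀ (r : ℝ) (z w : K), z * (r • w) = r • (z * w)
  gen_one : i o = 1
  ne : j ≠ o
  gen_mul_self : i j * i j = -1
  sum_coord : ∀ z : K, ∑ p, coord p z • i p = z
  coord_gen : ∀ p q, coord p (i q) = if p = q then 1 else 0
  star_add : ∀ z w : K, star (z + w) = star z + star w
  star_smul : ∀ (r : ℝ) (z : K), star (r • z) = r • star z
  star_one : star (1 : K) = 1
  star_gen : ∀ p, p ≠ o → star (i p) = -i p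
  norm_nonneg : ∀ z : K, 0 ≤ ‖z‖
  norm_sq : ∀ z : K, ‖z‖ ^ 2 = ∑ p, coord p z ^ 2
  star_mul_self : ∀ z : K, star z * z = (‖z‖ ^ 2) • (1 : K)
  continuous_coord : ∀ p, Continuous (coord p)

/-- The coordinates of a quaternion with respect to `quaternionGenerators`. -/
def quaternionCoord (p : Fin 4) : ℍ[ℝ] →ₗ[ℝ] ℝ where
  toFun z := ![z.re, z.imI, z.imJ, z.imK] p
  map_add' z w := by fin_cases p <;> rfl
  map_smul' r z := by fin_cases p <;> rfl

theorem quaternionCoord_apply (p : Fin 4) (z : ℍ[ℝ]) :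
    quaternionCoord p z = ![z.re, z.imI, z.imJ, z.imK] p := rfl

theorem quaternion_isGeneratorSystem :
    IsGeneratorSystem quaternionGenerators 0 1 quaternionCoord where
  smul_mul := smul_mul_assoc
  mul_smul := mul_smul_comm
  gen_one := by ext <;> simp [quaternionGenerators]
  ne := by decide
  gen_mul_self := by ext <;> simp [quaternionGenerators]
  sum_coord z := by
    ext <;> simp [quaternionGenerators, quaternionCoord_apply, Fin.sum_univ_four]
  coord_gen p q := by
    fin_cases p <;> fin_cases q <;> simp [quaternionGenerators, quaternionCoord_apply]
  star_add := star_add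
  star_smul r z := by simp
  star_one := star_one _
  star_gen p hp := by
    fin_cases p
    · exact absurd rfl hp
    all_goals ext <;> simp [quaternionGenerators]
  norm_nonneg := norm_nonneg
  norm_sq z := by
    simp [quaternionCoord_apply, Fin.sum_univ_four, sq, ← Quaternion.normSq_eq_norm_mul_self,
      Quaternion.normSq_def']
  star_mul_self z := by
    rw [Quaternion.star_mul_self, sq, ← Quaternion.normSq_eq_norm_mul_self]
    ext <;> simp
  continuous_coord p := by
    fin_cases p
    · exact Quaternion.continuous_re
    · exact Quaternion.continuous_imI
    · exact Quaternion.continuous_imJ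
    · exact Quaternion.continuous_imK

namespace Octonion

@[simp] theorem fst_smul (r : ℝ) (x : Octonion) : (r • x).fst = r • x.fst := rfl
@[simp] theorem snd_smul (r : ℝ) (x : Octonion) : (r • x).snd = r • x.snd := rfl
@[simp] theorem fst_neg (x : Octonion) : (-x).fst = -x.fst := rfl
@[simp] theorem snd_neg (x : Octonion) : (-x).snd = -x.snd := rfl

theorem continuous_fst : Continuous fst :=
  _root_.continuous_fst.comp (WithLp.prod_continuous_ofLp 2 ℍ[ℝ] ℍ[ℝ])

theorem continuous_snd : Continuous snd :=
  _root_.continuous_snd.comp (WithLp.prod_continuous_ofLp 2 ℍ[ℝ] ℍ[ℝ])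

theorem norm_sq_eq (x : Octonion) : ‖x‖ ^ 2 = ‖x.fst‖ ^ 2 + ‖x.snd‖ ^ 2 :=
  WithLp.prod_norm_sq_eq_of_L2 (α := ℍ[ℝ]) (β := ℍ[ℝ]) x

end Octonion

/-- The coordinates of an octonion with respect to `octonionGenerators`. -/
def octonionCoord (p : Fin 8) : Octonion →ₗ[ℝ] ℝ where
  toFun x := ![x.fst.re, x.fst.imI, x.fst.imJ, x.fst.imK,
    x.snd.re, x.snd.imI, x.snd.imJ, x.snd.imK] p
  map_add' x y := by fin_cases p <;> rfl
  map_smul' r x := by fin_cases p <;> rfl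

theorem octonionCoord_apply (p : Fin 8) (x : Octonion) :
    octonionCoord p x = ![x.fst.re, x.fst.imI, x.fst.imJ, x.fst.imK,
      x.snd.re, x.snd.imI, x.snd.imJ, x.snd.imK] p := rfl

theorem octonion_isGeneratorSystem :
    IsGeneratorSystem octonionGenerators 0 1 octonionCoord where
  smul_mul r z w := by apply Octonion.ext <;> simp [smul_sub, smul_add]
  mul_smul r z w := by apply Octonion.ext <;> simp [smul_sub, smul_add]
  gen_one := by
    apply Octonion.ext
    · exact quaternion_isGeneratorSystem.gen_one
    · rfl
  ne := by decide
  gen_mul_self := by apply Octonion.ext <;> ext <;> simp [octonionGenerators]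
  sum_coord z := by
    apply Octonion.ext <;> ext <;>
      simp [octonionGenerators, octonionCoord_apply, Fin.sum_univ_eight]
  coord_gen p q := by
    fin_cases p <;> fin_cases q <;> simp [octonionGenerators, octonionCoord_apply]
  star_add z w := by apply Octonion.ext <;> simp [add_comm]
  star_smul r z := by apply Octonion.ext <;> simp
  star_one := by apply Octonion.ext <;> simp
  star_gen p hp := by
    fin_cases p
    · exact absurd rfl hp
    all_goals apply Octonion.ext <;> ext <;> simp [octonionGenerators]
  norm_nonneg := norm_nonneg
  norm_sq z := by
    rw [Octonion.norm_sq_eq, quaternion_isGeneratorSystem.norm_sq,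
      quaternion_isGeneratorSystem.norm_sq]
    simp [octonionCoord_apply, quaternionCoord_apply, Fin.sum_univ_eight, Fin.sum_univ_four]
    ring
  star_mul_self z := by
    have h (q : ℍ[ℝ]) := quaternion_isGeneratorSystem.star_mul_self q
    apply Octonion.ext
    · simp [h, Octonion.norm_sq_eq, add_smul]
    · simp
  continuous_coord p := by
    have h (q) := (quaternion_isGeneratorSystem.continuous_coord q)
    fin_cases p
    · exact (h 0).comp Octonion.continuous_fst
    · exact (h 1).comp Octonion.continuous_fst
    · exact (h 2).comp Octonion.continuous_fst
    · exact (h 3).comp Octonion.continuous_fst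
    · exact (h 0).comp Octonion.continuous_snd
    · exact (h 1).comp Octonion.continuous_snd
    · exact (h 2).comp Octonion.continuous_snd
    · exact (h 3).comp Octonion.continuous_snd

/-! ### The complex C*-subalgebra of a quasicommutative C*-algebra -/

section Scalars

variable {K : Type*} [NonAssocRing K] [Module ℝ K] [Norm K] [Star K] [TopologicalSpace K]
  {ι : Type*} [Fintype ι] [DecidableEq ι] {i : ι → K} {o j : ι} {coord : ι → K →ₗ[ℝ] ℝ}

namespace IsGeneratorSystem

variable (G : IsGeneratorSystem i o j coord)
include G

theorem coord_one : coord o (1 : K) = 1 := by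
  rw [← G.gen_one, G.coord_gen, if_pos rfl]

theorem smul_one_injective : Function.Injective fun r : ℝ => r • (1 : K) := fun r s h => by
  have h' := congrArg (coord o) h
  simpa [G.coord_one] using h'

theorem star_gen_mul_gen : star (i j) * i j = 1 := by
  rw [G.star_gen j G.ne, neg_mul, G.gen_mul_self, neg_neg]

/-- The mean of `z` and its conjugate is the real part of `z`. -/
theorem half_smul_add_star (z : K) : (1 / 2 : ℝ) • (z + star z) = coord o z • (1 : K) := by
  let R : K →ₗ[ℝ] K :=
    { toFun := fun z => (1 / 2 : ℝ) • (z + star z)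
      map_add' := fun z w => by rw [G.star_add, ← smul_add]; congr 1; abel
      map_smul' := fun r z => by
        rw [G.star_smul, ← smul_add, smul_comm, RingHom.id_apply] }
  have hR : ∀ p, R (i p) = coord o (i p) • (1 : K) := fun p => by
    change (1 / 2 : ℝ) • (i p + star (i p)) = _
    rw [G.coord_gen]
    by_cases h : p = o
    · subst h
      rw [G.gen_one, G.star_one, if_pos rfl, ← two_smul ℝ (1 : K), smul_smul]
      norm_num
    · rw [G.star_gen p h, if_neg (Ne.symm h), add_neg_cancel, smul_zero, zero_smul]
  change R z = _
  conv_lhs => rw [← G.sum_coord z]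
  conv_rhs => rw [← G.sum_coord z]
  simp only [map_sum, map_smul, hR, Finset.sum_smul, smul_assoc]

/-- The copy `ℝ 1 + ℝ (i j)` of `ℂ` in `K` is isometrically embedded. -/
theorem norm_complex (c : ℂ) : ‖c.re • (1 : K) + c.im • i j‖ = ‖c‖ := by
  have h : ‖c.re • (1 : K) + c.im • i j‖ ^ 2 = ‖c‖ ^ 2 := by
    apply G.smul_one_injective
    change (‖c.re • (1 : K) + c.im • i j‖ ^ 2) • (1 : K) = (‖c‖ ^ 2) • (1 : K)
    rw [← G.star_mul_self, G.star_add, G.star_smul, G.star_smul, G.star_one, G.star_gen j G.ne,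
      add_mul, mul_add, mul_add, G.smul_mul, G.smul_mul, G.smul_mul, G.smul_mul, G.mul_smul,
      G.mul_smul, G.mul_smul, G.mul_smul, one_mul, one_mul, mul_one, neg_mul, G.gen_mul_self,
      Complex.sq_norm, Complex.normSq_apply]
    module
  exact (sq_eq_sq₀ (G.norm_nonneg _) (_root_.norm_nonneg _)).1 h

end IsGeneratorSystem

end Scalars

theorem IsCStarAlgebraOver.norm_star {K A : Type*} [NonAssocRing K] [Module ℝ K] [Norm K] [Star K]
    [NonAssocUnitalNormedRing A] [NormedSpace ℝ A] [SMul K A] [SMul Kᵐᵒᵖ A] [Star A]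
    (hA : IsCStarAlgebraOver K A) (x : A) : ‖star x‖ = ‖x‖ := by
  have key : ∀ y : A, ‖y‖ ≤ ‖star y‖ := fun y => by
    rcases (norm_nonneg y).eq_or_lt with h | h
    · rw [← h]
      exact norm_nonneg _
    · refine le_of_mul_le_mul_right ?_ h
      rw [← sq, ← hA.norm_star_mul_self_eq]
      exact NonAssocUnitalNormedRing.norm_mul_le_mul _ _
  refine le_antisymm ?_ (key x)
  simpa only [hA.star_star_eq] using key (star x)

theorem IsCStarAlgebraOver.continuous_star {K A : Type*} [NonAssocRing K] [Module ℝ K] [Norm K]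
    [Star K] [NonAssocUnitalNormedRing A] [NormedSpace ℝ A] [SMul K A] [SMul Kᵐᵒᵖ A] [Star A]
    (hA : IsCStarAlgebraOver K A) : Continuous (star : A → A) :=
  (AddMonoidHomClass.isometry_of_norm (AddMonoidHom.mk' star hA.star_add_eq)
    hA.norm_star).continuous

theorem IsBanachAlgebraOver.continuous_const_smul {K A : Type*} [NonAssocRing K] [Module ℝ K]
    [Norm K] [NonAssocUnitalNormedRing A] [NormedSpace ℝ A] [SMul K A] [SMul Kᵐᵒᵖ A]
    (hA : IsBanachAlgebraOver K A) (c : K) : Continuous fun x : A => c • x :=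
  AddMonoidHomClass.continuous_of_bound (AddMonoidHom.mk' (fun x : A => c • x) (hA.smul_add c)) ‖c‖
    fun x => (hA.norm_smul_eq c x).le

namespace QuasicommutativeDecomposition

variable {K : Type*} [NonAssocRing K] [Module ℝ K] {ι : Type*} [Fintype ι] {i : ι → K}
  {A₀ A : Type*} [CommRing A₀] [Algebra ℝ A₀]
  [NonAssocUnitalNormedRing A] [NormedSpace ℝ A] [SMul K A] [SMul Kᵐᵒᵖ A]
  (D : QuasicommutativeDecomposition i A₀ A)

/-- The family of coefficients `a p` of `x = ∑ a p (i p)`. -/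
def coeffEquiv : A ≃ₗ[ℝ] (ι → A₀) :=
  (LinearEquiv.ofBijective
    { toFun := fun x => ∑ p, D.term (x p) (i p)
      map_add' := fun x y => by simp [Finset.sum_add_distrib]
      map_smul' := fun r x => by simp [Finset.smul_sum] } D.bijective).symm

theorem sum_term_coeffEquiv (x : A) : ∑ p, D.term (D.coeffEquiv x p) (i p) = x :=
  D.coeffEquiv.symm_apply_apply x

/-- Additive maps on `A` are determined by their values at the elements `a z`. -/
theorem addMonoidHom_ext {B : Type*} [AddCommMonoid B] {φ ψ : A →+ B}
    (h : ∀ a z, φ (D.term a z) = ψ (D.term a z)) (x : A) : φ x = ψ x := by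
  rw [← D.sum_term_coeffEquiv x, map_sum, map_sum]
  exact Finset.sum_congr rfl fun p _ => h _ _

/-- The embedding `a + b ω ↦ a 1 + b (i j)` of the complexification of `A₀` into `A`. -/
def ofComplexification (j : ι) : Complexification A₀ →+ A where
  toFun x := D.term x.re 1 + D.term x.im (i j)
  map_zero' := by simp
  map_add' x y := by simp; abel

theorem ofComplexification_apply (j : ι) (x : Complexification A₀) :
    D.ofComplexification j x = D.term x.re 1 + D.term x.im (i j) := rfl

variable [Norm K] [Star K] [TopologicalSpace K] [DecidableEq ι] {o j : ι} {coord : ι → K →ₗ[ℝ] ℝ}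
  (G : IsGeneratorSystem i o j coord)

include G in
theorem coeffEquiv_term (a : A₀) (z : K) (p : ι) :
    D.coeffEquiv (D.term a z) p = coord p z • a := by
  have h : D.coeffEquiv.symm (fun p => coord p z • a) = D.term a z := by
    change ∑ p, D.term (coord p z • a) (i p) = D.term a z
    conv_rhs => rw [← G.sum_coord z]
    simp
  rw [← h, LinearEquiv.apply_symm_apply]

include G in
theorem ofComplexification_mul (x y : Complexification A₀) :
    D.ofComplexification j (x * y) = D.ofComplexification j x * D.ofComplexification j y := by
  simp only [ofComplexification_apply, add_mul, mul_add, D.term_mul_term, one_mul, mul_one,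
    G.gen_mul_self, QuadraticAlgebra.re_mul, QuadraticAlgebra.im_mul, map_add, map_neg,
    LinearMap.add_apply, LinearMap.neg_apply, neg_mul, zero_mul, add_zero]
  abel

include G in
theorem coeffEquiv_ofComplexification_re (x : Complexification A₀) :
    D.coeffEquiv (D.ofComplexification j x) o = x.re := by
  rw [ofComplexification_apply, map_add, Pi.add_apply, D.coeffEquiv_term G, D.coeffEquiv_term G,
    G.coord_one, G.coord_gen, if_neg G.ne.symm, one_smul, zero_smul, add_zero]

variable [Star A]

include G in
theorem star_term (hA : IsCStarAlgebraOver K A)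
    (hD : ∀ (a : A₀) (p : ι), star (D.term a (i p)) = D.term a (star (i p))) (a : A₀) (z : K) :
    star (D.term a z) = D.term a (star z) := by
  let φ : K →+ A := (AddMonoidHom.mk' star hA.star_add_eq).comp (D.term a).toAddMonoidHom
  let ψ : K →+ A := (D.term a).toAddMonoidHom.comp (AddMonoidHom.mk' star G.star_add)
  change φ z = ψ z
  rw [← G.sum_coord z, map_sum, map_sum]
  refine Finset.sum_congr rfl fun p _ => ?_
  change star (D.term a (coord p z • i p)) = D.term a (star (coord p z • i p))
  have h : ∀ (r : ℝ) (w : K), D.term a (r • w) = D.term (r • a) w := fun r w => by simp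
  rw [G.star_smul, h, h, hD]

include G in
/-- The mean of `x` and `x*` is the component of `x` in `A₀ 1`. In particular this component depends
continuously on `x`. -/
theorem half_smul_add_star (hA : IsCStarAlgebraOver K A)
    (hD : ∀ (a : A₀) (p : ι), star (D.term a (i p)) = D.term a (star (i p))) (x : A) :
    (1 / 2 : ℝ) • (x + star x) = D.term (D.coeffEquiv x o) 1 := by
  let φ : A →+ A := AddMonoidHom.mk' (fun x => (1 / 2 : ℝ) • (x + star x)) fun x y => by
    rw [hA.star_add_eq, ← smul_add]; congr 1; abel
  let ψ : A →+ A := AddMonoidHom.mk' (fun x => D.term (D.coeffEquiv x o) 1) fun x y => by simp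
  refine D.addMonoidHom_ext (φ := φ) (ψ := ψ) (fun a z => ?_) x
  change (1 / 2 : ℝ) • (D.term a z + star (D.term a z)) = D.term (D.coeffEquiv (D.term a z) o) 1
  rw [D.star_term G hA hD, ← map_add, ← map_smul, G.half_smul_add_star, D.coeffEquiv_term G,
    map_smul, map_smul, LinearMap.smul_apply]

include G in
/-- The imaginary coefficient is the component in `A₀ 1` after multiplication by `(i j)* = -(i j)`. -/
theorem coeffEquiv_smul_ofComplexification (hA : IsCStarAlgebraOver K A)
    (x : Complexification A₀) :
    D.coeffEquiv (star (i j) • D.ofComplexification j x) o = x.im := by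
  rw [ofComplexification_apply, hA.smul_add, D.smul_term, D.smul_term, mul_one, G.star_gen_mul_gen,
    map_add, Pi.add_apply, D.coeffEquiv_term G, D.coeffEquiv_term G, G.coord_one,
    G.star_gen j G.ne, map_neg, G.coord_gen, if_neg G.ne.symm, one_smul, neg_zero, zero_smul,
    zero_add]

include G in
theorem ofComplexification_injective (hA : IsCStarAlgebraOver K A) :
    Function.Injective (D.ofComplexification j) := fun x y h => by
  ext
  · rw [← D.coeffEquiv_ofComplexification_re G x, h, D.coeffEquiv_ofComplexification_re G]
  · rw [← D.coeffEquiv_smul_ofComplexification G hA x, h,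
      D.coeffEquiv_smul_ofComplexification G hA]

include G in
/-- The range is closed: it consists of the solutions of `x = R x + (i j) R ((i j)* x)`, where `R`
is the continuous projection `x ↦ (x + x*) / 2` onto `A₀ 1`. -/
theorem isComplete_range_ofComplexification (hA : IsCStarAlgebraOver K A)
    (hD : ∀ (a : A₀) (p : ι), star (D.term a (i p)) = D.term a (star (i p))) :
    IsComplete (Set.range (D.ofComplexification j)) := by
  have : CompleteSpace A := hA.complete
  let R : A → A := fun x => (1 / 2 : ℝ) • (x + star x)
  have hR : ∀ x, R x = D.term (D.coeffEquiv x o) 1 := D.half_smul_add_star G hA hD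
  have hRc : Continuous R := (continuous_id.add hA.continuous_star).const_smul _
  have hs := hA.continuous_const_smul
  have : Set.range (D.ofComplexification j) = {x | x = R x + i j • R (star (i j) • x)} := by
    ext x
    simp only [Set.mem_ofPred_eq, hR, D.smul_term, mul_one]
    constructor
    · rintro ⟨y, rfl⟩
      rw [D.coeffEquiv_ofComplexification_re G, D.coeffEquiv_smul_ofComplexification G hA,
        ofComplexification_apply]
    · exact fun h => ⟨⟨_, _⟩, h.symm⟩
  rw [this]
  exact (isClosed_eq continuous_id
    (hRc.add ((hs _).comp (hRc.comp (hs _))))).isComplete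

include G in
theorem ofComplexification_star (hA : IsCStarAlgebraOver K A)
    (hD : ∀ (a : A₀) (p : ι), star (D.term a (i p)) = D.term a (star (i p)))
    (x : Complexification A₀) :
    D.ofComplexification j (star x) = star (D.ofComplexification j x) := by
  simp only [ofComplexification_apply, hA.star_add_eq, D.star_term G hA hD, G.star_one,
    G.star_gen j G.ne, QuadraticAlgebra.re_star, QuadraticAlgebra.im_star, zero_mul, add_zero,
    map_neg, LinearMap.neg_apply]

include G in
theorem ofComplexification_smul (hA : IsCStarAlgebraOver K A) (c : ℂ) (x : Complexification A₀) :
    D.ofComplexification j (c • x)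
      = (c.re • (1 : K) + c.im • i j) • D.ofComplexification j x := by
  simp only [ofComplexification_apply, Complexification.smul_def, hA.smul_add, D.smul_term, add_mul,
    G.smul_mul, one_mul, mul_one, G.gen_mul_self, map_add, map_sub, map_smul, LinearMap.sub_apply,
    LinearMap.add_apply, LinearMap.smul_apply, map_neg]
  module

end QuasicommutativeDecomposition

/-! ### Representation by continuous functions -/

namespace QuasicommutativeDecomposition

variable {K : Type*} [NonAssocRing K] [Module ℝ K] {ι : Type*} [Fintype ι] {i : ι → K}
  {A₀ A : Type*} [CommRing A₀] [Algebra ℝ A₀]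
  [NonAssocUnitalNormedRing A] [NormedSpace ℝ A] [SMul K A] [SMul Kᵐᵒᵖ A]
  (D : QuasicommutativeDecomposition i A₀ A)
  {X : Type*} [TopologicalSpace X] (e : A₀ ≃ₐ[ℝ] C(X, ℝ))

/-- The value `∑ a p (t) (i p)` of `x = ∑ a p (i p)` at the point `t`, where `A₀` is identified with
`C(X, ℝ)` by means of `e`. -/
def evalAt (t : X) : A →+ K where
  toFun x := ∑ p, e (D.coeffEquiv x p) t • i p
  map_zero' := by simp
  map_add' x y := by simp [add_smul, Finset.sum_add_distrib]

theorem evalAt_apply (t : X) (x : A) : D.evalAt e t x = ∑ p, e (D.coeffEquiv x p) t • i p := rfl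

variable [Norm K] [Star K] [TopologicalSpace K] [DecidableEq ι] {o j : ι} {coord : ι → K →ₗ[ℝ] ℝ}
  (G : IsGeneratorSystem i o j coord)

include G in
theorem evalAt_term (t : X) (a : A₀) (z : K) : D.evalAt e t (D.term a z) = e a t • z := by
  rw [evalAt_apply]
  conv_rhs => rw [← G.sum_coord z]
  simp only [D.coeffEquiv_term G, map_smul, ContinuousMap.smul_apply, Finset.smul_sum, smul_smul,
    smul_eq_mul, mul_comm]

include G in
theorem coord_evalAt (t : X) (x : A) (p : ι) :
    coord p (D.evalAt e t x) = e (D.coeffEquiv x p) t := by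
  simp [evalAt_apply, G.coord_gen]

include G in
theorem evalAt_injective {x y : A} (h : ∀ t, D.evalAt e t x = D.evalAt e t y) : x = y := by
  apply D.coeffEquiv.injective
  ext p
  apply e.injective
  ext t
  rw [← D.coord_evalAt e G, h, D.coord_evalAt e G]

include G in
theorem evalAt_mul (t : X) (x y : A) : D.evalAt e t (x * y) = D.evalAt e t x * D.evalAt e t y := by
  let φ : A →+ A →+ K := (AddMonoidHom.compr₂ AddMonoidHom.mul (D.evalAt e t))
  let ψ : A →+ A →+ K := (AddMonoidHom.mul.compl₂ (D.evalAt e t)).comp (D.evalAt e t)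
  change φ x y = ψ x y
  congr 1
  refine D.addMonoidHom_ext (fun a z => ?_) x
  ext y
  refine D.addMonoidHom_ext (fun b w => ?_) y
  change D.evalAt e t (D.term a z * D.term b w)
    = D.evalAt e t (D.term a z) * D.evalAt e t (D.term b w)
  rw [D.term_mul_term, D.evalAt_term e G, D.evalAt_term e G, D.evalAt_term e G, G.smul_mul,
    G.mul_smul, smul_smul, map_mul, ContinuousMap.mul_apply]

include G in
theorem evalAt_one (t : X) : D.evalAt e t 1 = 1 := by
  rw [← D.term_one_one, D.evalAt_term e G, map_one, ContinuousMap.one_apply, one_smul]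

include G in
theorem evalAt_smul (hA : IsBanachAlgebraOver K A) (t : X) (c : K) (x : A) :
    D.evalAt e t (c • x) = c * D.evalAt e t x := by
  let φ : A →+ K := (D.evalAt e t).comp (AddMonoidHom.mk' (fun x : A => c • x) (hA.smul_add c))
  let ψ : A →+ K := (AddMonoidHom.mulLeft c).comp (D.evalAt e t)
  refine D.addMonoidHom_ext (φ := φ) (ψ := ψ) (fun a z => ?_) x
  change D.evalAt e t (c • D.term a z) = c * D.evalAt e t (D.term a z)
  rw [D.smul_term, D.evalAt_term e G, D.evalAt_term e G, G.mul_smul]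

include G in
theorem evalAt_op_smul (hA : IsBanachAlgebraOver K A) (t : X) (c : K) (x : A) :
    D.evalAt e t (MulOpposite.op c • x) = D.evalAt e t x * c := by
  let φ : A →+ K := (D.evalAt e t).comp
    (AddMonoidHom.mk' (fun x : A => MulOpposite.op c • x) (hA.op_smul_add c))
  let ψ : A →+ K := (AddMonoidHom.mulRight c).comp (D.evalAt e t)
  refine D.addMonoidHom_ext (φ := φ) (ψ := ψ) (fun a z => ?_) x
  change D.evalAt e t (MulOpposite.op c • D.term a z) = D.evalAt e t (D.term a z) * c
  rw [D.op_smul_term, D.evalAt_term e G, D.evalAt_term e G, G.smul_mul]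

variable [Star A]

include G in
theorem evalAt_star (hA : IsCStarAlgebraOver K A)
    (hD : ∀ (a : A₀) (p : ι), star (D.term a (i p)) = D.term a (star (i p))) (t : X) (x : A) :
    D.evalAt e t (star x) = star (D.evalAt e t x) := by
  let φ : A →+ K := (D.evalAt e t).comp (AddMonoidHom.mk' star hA.star_add_eq)
  let ψ : A →+ K := (AddMonoidHom.mk' star G.star_add).comp (D.evalAt e t)
  refine D.addMonoidHom_ext (φ := φ) (ψ := ψ) (fun a z => ?_) x
  change D.evalAt e t (star (D.term a z)) = star (D.evalAt e t (D.term a z))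
  rw [D.star_term G hA hD, D.evalAt_term e G, D.evalAt_term e G, G.star_smul]

include G e in
/-- If `x = ∑ a p (i p)`, then `x* x = ∑ (a p)²`: this holds at every point, because `z̃ z = |z|²`
in `K`. -/
theorem star_mul_self_eq_term (hA : IsCStarAlgebraOver K A)
    (hD : ∀ (a : A₀) (p : ι), star (D.term a (i p)) = D.term a (star (i p))) (x : A) :
    star x * x = D.term (∑ p, D.coeffEquiv x p ^ 2) 1 := by
  refine D.evalAt_injective e G fun t => ?_
  rw [D.evalAt_mul e G, D.evalAt_star e G hA hD, G.star_mul_self, D.evalAt_term e G, G.norm_sq]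
  simp [D.coord_evalAt e G]

include G in
/-- The norm of `A` is the supremum norm: by the C*-identity `‖x‖²` is the norm of `x* x`, an element
of `A₀`, and the norm of `A₀` is the supremum norm. -/
theorem isLUB_norm_evalAt [CompactSpace X] (hA : IsCStarAlgebraOver K A)
    (hD : ∀ (a : A₀) (p : ι), star (D.term a (i p)) = D.term a (star (i p)))
    (he : ∀ a, ‖e a‖ = ‖D.term a 1‖) (x : A) :
    IsLUB (Set.range fun t => ‖D.evalAt e t x‖) ‖x‖ := by
  let q : C(X, ℝ) := e (∑ p, D.coeffEquiv x p ^ 2)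
  have hq : ‖q‖ = ‖x‖ ^ 2 := by
    rw [he, ← D.star_mul_self_eq_term e G hA hD, hA.norm_star_mul_self_eq]
  have hqt : ∀ t, q t = ‖D.evalAt e t x‖ ^ 2 := fun t => by
    simp [q, G.norm_sq, D.coord_evalAt e G]
  -- A norm of the unit equal to one excludes the zero algebra, whose spectrum is empty.
  have : Nonempty X := by
    by_contra hX
    rw [not_nonempty_iff] at hX
    have h1 : ‖e 1‖ = 1 := by
      rw [he, D.term_one_one, NonAssocUnitalNormedRing.norm_one_eq]
    rw [Subsingleton.elim (e 1) 0, norm_zero] at h1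
    exact zero_ne_one h1
  constructor
  · rintro _ ⟨t, rfl⟩
    refine (sq_le_sq₀ (G.norm_nonneg _) (norm_nonneg _)).1 ?_
    rw [← hqt, ← hq]
    exact (le_abs_self _).trans (q.norm_coe_le_norm t)
  · intro u hu
    have hu' : ∀ t, ‖D.evalAt e t x‖ ≤ u := fun t => hu ⟨t, rfl⟩
    have hu0 : 0 ≤ u := (G.norm_nonneg _).trans (hu' (Classical.arbitrary X))
    refine (sq_le_sq₀ (norm_nonneg _) hu0).1 ?_
    rw [← hq]
    refine (ContinuousMap.norm_le _ (sq_nonneg u)).2 fun t => ?_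
    rw [hqt, Real.norm_of_nonneg (sq_nonneg _)]
    exact pow_le_pow_left₀ (G.norm_nonneg _) (hu' t) 2

variable [ContinuousAdd K] [ContinuousSMul ℝ K]

/-- The bijection between `A` and `C(X, K)` given by pointwise evaluation. -/
def equivContinuousMap : A ≃ C(X, K) where
  toFun x := ⟨fun t => D.evalAt e t x, by simp only [evalAt_apply]; fun_prop⟩
  invFun F := ∑ p,
    D.term (e.symm ⟨fun t => coord p (F t), (G.continuous_coord p).comp F.continuous⟩) (i p)
  left_inv x := by
    refine D.evalAt_injective e G fun t => ?_
    simp [D.evalAt_term e G, D.coord_evalAt e G]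
    rfl
  right_inv F := by
    ext t
    simp [D.evalAt_term e G, G.sum_coord]

theorem equivContinuousMap_isIsometricStarIsomorphism [CompactSpace X]
    (hA : IsCStarAlgebraOver K A)
    (hD : ∀ (a : A₀) (p : ι), star (D.term a (i p)) = D.term a (star (i p)))
    (he : ∀ a, ‖e a‖ = ‖D.term a 1‖) :
    IsIsometricStarIsomorphism (D.equivContinuousMap e G) where
  map_add x y t := map_add (D.evalAt e t) x y
  map_mul x y t := D.evalAt_mul e G t x y
  map_one t := D.evalAt_one e G t
  map_smul c x t := D.evalAt_smul e G hA.toIsBanachAlgebraOver t c x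
  map_op_smul c x t := D.evalAt_op_smul e G hA.toIsBanachAlgebraOver t c x
  map_star x t := D.evalAt_star e G hA hD t x
  norm_isLUB x := D.isLUB_norm_evalAt e G hA hD he x

end QuasicommutativeDecomposition

/-- A quasicommutative C*-algebra over `K` is isometrically *-isomorphic to `C(X, K)` for some
compact Hausdorff space `X`. -/
theorem IsQuasicommutativeCStarAlgebra.exists_equiv_continuousMap.{u} {K : Type*} [NonAssocRing K]
    [Module ℝ K] [Norm K] [Star K] [TopologicalSpace K] [ContinuousAdd K] [ContinuousSMul ℝ K]
    {ι : Type*} [Fintype ι] [DecidableEq ι] {i : ι → K} {o j : ι} {coord : ι → K →ₗ[ℝ] ℝ}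
    (G : IsGeneratorSystem i o j coord) {A : Type u} [NonAssocUnitalNormedRing A]
    [NormedSpace ℝ A] [SMul K A] [SMul Kᵐᵒᵖ A] [Star A]
    (hA : IsQuasicommutativeCStarAlgebra i A) :
    ∃ (X : Type u) (_ : TopologicalSpace X) (_ : CompactSpace X) (_ : T2Space X)
      (Ψ : A ≃ C(X, K)), IsIsometricStarIsomorphism Ψ := by
  obtain ⟨hC, A₀, _, _, D, hD⟩ := hA
  obtain ⟨X, _, _, _, e, he⟩ := exists_algEquiv_continuousMap_real (D.ofComplexification j)
    (D.ofComplexification_injective G hC) (D.isComplete_range_ofComplexification G hC hD)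
    (fun x y => by
      rw [D.ofComplexification_mul G]
      exact NonAssocUnitalNormedRing.norm_mul_le_mul _ _)
    (fun c x => by rw [D.ofComplexification_smul G hC, hC.norm_smul_eq, G.norm_complex])
    (fun x => by
      rw [D.ofComplexification_mul G, D.ofComplexification_star G hC hD, hC.norm_star_mul_self_eq])
  refine ⟨X, inferInstance, inferInstance, inferInstance, D.equivContinuousMap e G,
    D.equivContinuousMap_isIsometricStarIsomorphism e G hC hD fun a => ?_⟩
  rw [he, D.ofComplexification_apply, map_zero, LinearMap.zero_apply, add_zero]

/-! ### Maximal ideals and the spectrum -/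

theorem IsGeneratorSystem.eq_zero_of_norm_sq {K : Type*} [NonAssocRing K] [Module ℝ K] [Norm K]
    [Star K] [TopologicalSpace K] {ι : Type*} [Fintype ι] [DecidableEq ι] {i : ι → K} {o j : ι}
    {coord : ι → K →ₗ[ℝ] ℝ} (G : IsGeneratorSystem i o j coord) {z : K} (h : ‖z‖ ^ 2 = 0) :
    z = 0 := by
  rw [G.norm_sq, Finset.sum_eq_zero_iff_of_nonneg fun _ _ => sq_nonneg _] at h
  rw [← G.sum_coord z]
  exact Finset.sum_eq_zero fun p hp => by rw [pow_eq_zero_iff two_ne_zero |>.1 (h p hp), zero_smul]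

namespace IsIsometricStarIsomorphism

section OfReal

variable {K A X : Type*} [NonAssocRing K] [Module ℝ K] [TopologicalSpace K] [ContinuousSMul ℝ K]
  [TopologicalSpace X] (Ψ : A ≃ C(X, K))

/-- The element of `A` that corresponds to the real-valued function `f`. -/
def ofReal (f : C(X, ℝ)) : A := Ψ.symm ⟨fun t => f t • (1 : K), by fun_prop⟩

theorem apply_ofReal (f : C(X, ℝ)) (t : X) : Ψ (ofReal Ψ f) t = f t • (1 : K) := by
  simp [ofReal]

end OfReal

variable {K : Type*} [NonAssocRing K] [Norm K] [Star K] [TopologicalSpace K]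
  {A : Type*} [NonAssocUnitalNormedRing A] [SMul K A] [SMul Kᵐᵒᵖ A] [Star A]
  {X : Type*} [TopologicalSpace X] {Ψ : A ≃ C(X, K)} (hΨ : IsIsometricStarIsomorphism Ψ)

/-- Evaluation at the point `t`. -/
def evalHom (t : X) : A →+ K := AddMonoidHom.mk' (fun x => Ψ x t) fun x y => hΨ.map_add x y t

theorem mem_ker_evalHom {t : X} {x : A} : x ∈ (hΨ.evalHom t).ker ↔ Ψ x t = 0 := Iff.rfl

theorem isIdealOver_ker_evalHom (t : X) : IsIdealOver K (hΨ.evalHom t).ker where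
  mul_mem_left a x hx := by
    rw [mem_ker_evalHom] at hx ⊢
    rw [hΨ.map_mul, hx, mul_zero]
  mul_mem_right a x hx := by
    rw [mem_ker_evalHom] at hx ⊢
    rw [hΨ.map_mul, hx, zero_mul]
  smul_mem c x hx := by
    rw [mem_ker_evalHom] at hx ⊢
    rw [hΨ.map_smul, hx, mul_zero]
  op_smul_mem c x hx := by
    rw [mem_ker_evalHom] at hx ⊢
    rw [hΨ.map_op_smul, hx, zero_mul]

theorem sub_smul_one_mem_ker_evalHom {t : X} {x : A} {c : K} :
    x - c • (1 : A) ∈ (hΨ.evalHom t).ker ↔ Ψ x t = c := by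
  rw [AddMonoidHom.mem_ker, map_sub, sub_eq_zero]
  change Ψ x t = Ψ (c • 1) t ↔ _
  rw [hΨ.map_smul, hΨ.map_one, mul_one]

include hΨ in
/-- Transport of the isomorphism along a homeomorphism of the underlying spaces. -/
theorem arrowCongr {Y : Type*} [TopologicalSpace Y] (h : X ≃ₜ Y) :
    IsIsometricStarIsomorphism (Ψ.trans (h.continuousMapCongr (Homeomorph.refl K))) where
  map_add x y t := hΨ.map_add x y _
  map_mul x y t := hΨ.map_mul x y _
  map_one t := hΨ.map_one _
  map_smul c x t := hΨ.map_smul c x _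
  map_op_smul c x t := hΨ.map_op_smul c x _
  map_star x t := hΨ.map_star x _
  norm_isLUB x := by
    convert! hΨ.norm_isLUB x using 1
    exact h.symm.surjective.range_comp fun t => ‖Ψ x t‖

variable [Module ℝ K] {ι : Type*} [Fintype ι] [DecidableEq ι] {i : ι → K} {o j : ι}
  {coord : ι → K →ₗ[ℝ] ℝ} (G : IsGeneratorSystem i o j coord)

include G in
theorem ker_evalHom_ne_top (t : X) : (hΨ.evalHom t).ker ≠ ⊤ := fun h => by
  have h1 : (1 : A) ∈ (hΨ.evalHom t).ker := h ▸ AddSubgroup.mem_top _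
  rw [mem_ker_evalHom, hΨ.map_one] at h1
  simpa [G.coord_one] using congrArg (coord o) h1

variable [ContinuousSMul ℝ K] [CompactSpace X] [T2Space X]

include hΨ G in
/-- Every proper ideal vanishes at some point. The real-valued functions that it contains form a
proper ideal of `C(X, ℝ)`, which vanishes at some point `t`; since `|x|² = x* x` is in the ideal
whenever `x` is, `x` vanishes at `t` as well. -/
theorem exists_ideal_le_ker_evalHom {I : AddSubgroup A}
    (hI : IsIdealOver K I) (hne : I ≠ ⊤) : ∃ t, I ≤ (hΨ.evalHom t).ker := by
  -- The ideal of the real-valued functions that belong to `I`.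
  let I₀ : Ideal C(X, ℝ) :=
    { carrier := {f | ofReal Ψ f ∈ I}
      zero_mem' := by
        have h : ofReal Ψ (0 : C(X, ℝ)) = 0 := by
          apply Ψ.injective
          ext t
          rw [apply_ofReal, show Ψ 0 t = 0 from map_zero (hΨ.evalHom t)]
          exact zero_smul ℝ _
        change ofReal Ψ (0 : C(X, ℝ)) ∈ I
        rw [h]
        exact I.zero_mem
      add_mem' := fun {f g} hf hg => by
        have h : ofReal Ψ (f + g) = ofReal Ψ f + ofReal Ψ g := by
          apply Ψ.injective
          ext t
          rw [hΨ.map_add, apply_ofReal, apply_ofReal, apply_ofReal, ← add_smul]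
          rfl
        change ofReal Ψ (f + g) ∈ I
        rw [h]
        exact I.add_mem hf hg
      smul_mem' := fun f g hg => by
        have h : ofReal Ψ (f * g) = ofReal Ψ f * ofReal Ψ g := by
          apply Ψ.injective
          ext t
          rw [hΨ.map_mul, apply_ofReal, apply_ofReal, apply_ofReal, G.smul_mul, one_mul, smul_smul]
          rfl
        change ofReal Ψ (f * g) ∈ I
        rw [h]
        exact hI.mul_mem_left _ _ hg }
  have hI₀ : I₀ ≠ ⊤ := fun h => hne <| by
    have h1 : ofReal Ψ (1 : C(X, ℝ)) = 1 := by
      apply Ψ.injective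
      ext t
      rw [hΨ.map_one, apply_ofReal]
      exact one_smul ℝ _
    have h2 : ofReal Ψ (1 : C(X, ℝ)) ∈ I := (Ideal.eq_top_iff_one I₀).1 h
    rw [h1] at h2
    exact (AddSubgroup.eq_top_iff' I).2 fun x => by simpa using hI.mul_mem_left x 1 h2
  obtain ⟨J, hJ, hIJ⟩ := I₀.exists_le_maximal hI₀
  obtain ⟨t, ht⟩ := ContinuousMap.setOfIdeal_eq_compl_singleton J
  refine ⟨t, fun x hx => ?_⟩
  let q : C(X, ℝ) := ⟨fun s => ∑ p, coord p (Ψ x s) ^ 2,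
    continuous_finsetSum _ fun p _ => ((G.continuous_coord p).comp (Ψ x).continuous).pow 2⟩
  have hq : ofReal Ψ q = star x * x := by
    apply Ψ.injective
    ext s
    rw [apply_ofReal, hΨ.map_mul, hΨ.map_star, G.star_mul_self, G.norm_sq]
    rfl
  have hqJ : q ∈ J := hIJ (show ofReal Ψ q ∈ I from hq ▸ hI.mul_mem_left _ _ hx)
  have hqt : q t = 0 := ContinuousMap.notMem_setOfIdeal.1 (by simp [ht]) hqJ
  exact G.eq_zero_of_norm_sq ((G.norm_sq _).trans hqt)

include G in
theorem eq_of_ker_evalHom_le {s t : X}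
    (h : (hΨ.evalHom t).ker ≤ (hΨ.evalHom s).ker) : s = t := by
  by_contra hst
  obtain ⟨g, hgt, hgs, -⟩ := exists_continuous_zero_one_of_isClosed
    (isClosed_singleton (x := t)) (isClosed_singleton (x := s))
    (Set.disjoint_singleton.2 (Ne.symm hst))
  have h1 : ofReal Ψ g ∈ (hΨ.evalHom s).ker := h <| by
    rw [mem_ker_evalHom, apply_ofReal, hgt rfl]
    exact zero_smul ℝ _
  rw [mem_ker_evalHom, apply_ofReal, hgs rfl] at h1
  exact one_ne_zero (G.smul_one_injective (h1.trans (zero_smul ℝ _).symm))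

include G in
theorem isMaximalIdealOver_ker_evalHom (t : X) : IsMaximalIdealOver K (hΨ.evalHom t).ker := by
  refine ⟨hΨ.isIdealOver_ker_evalHom t, hΨ.ker_evalHom_ne_top G t, fun J hJ hle hne => ?_⟩
  obtain ⟨s, hs⟩ := hΨ.exists_ideal_le_ker_evalHom G hJ hne
  obtain rfl := hΨ.eq_of_ker_evalHom_le G (hle.trans hs)
  exact le_antisymm hs hle

/-- The maximal ideal of the elements that vanish at `t`. -/
def toMaximalIdealSpace (t : X) : MaximalIdealSpace K A :=
  ⟨(hΨ.evalHom t).ker, hΨ.isMaximalIdealOver_ker_evalHom G t⟩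

theorem toMaximalIdealSpace_bijective : Function.Bijective (hΨ.toMaximalIdealSpace G) := by
  refine ⟨fun s t h => ?_, fun M => ?_⟩
  · exact (hΨ.eq_of_ker_evalHom_le G (congrArg Subtype.val h).ge)
  · obtain ⟨t, ht⟩ := hΨ.exists_ideal_le_ker_evalHom G M.2.1 M.2.2.1
    exact ⟨t, Subtype.ext (M.2.2.2 _ (hΨ.isIdealOver_ker_evalHom t) ht
      (hΨ.ker_evalHom_ne_top G t))⟩

theorem sub_smul_one_mem_toMaximalIdealSpace {t : X} {x : A} {c : K} :
    x - c • (1 : A) ∈ (hΨ.toMaximalIdealSpace G t).1 ↔ Ψ x t = c :=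
  hΨ.sub_smul_one_mem_ker_evalHom

theorem gelfandValue_toMaximalIdealSpace (t : X) (x : A) :
    gelfandValue (hΨ.toMaximalIdealSpace G t) x = Ψ x t := by
  have h : ∃ c : K, x - c • (1 : A) ∈ (hΨ.toMaximalIdealSpace G t).1 :=
    ⟨Ψ x t, (hΨ.sub_smul_one_mem_toMaximalIdealSpace G).2 rfl⟩
  rw [gelfandValue, dif_pos h]
  exact ((hΨ.sub_smul_one_mem_toMaximalIdealSpace G).1 h.choose_spec).symm

theorem continuous_toMaximalIdealSpace : Continuous (hΨ.toMaximalIdealSpace G) := by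
  refine continuous_iInf_rng.2 fun x => continuous_induced_rng.2 ?_
  refine (Ψ x).continuous.congr fun t => ?_
  exact (hΨ.gelfandValue_toMaximalIdealSpace G t x).symm

theorem _root_.continuous_gelfandValue {K A : Type*} [NonAssocRing K] [TopologicalSpace K]
    [NonAssocUnitalNormedRing A] [SMul K A] [SMul Kᵐᵒᵖ A] (x : A) :
    Continuous fun M : MaximalIdealSpace K A => gelfandValue M x :=
  continuous_iInf_dom (i := x) continuous_induced_dom

include hΨ G in
theorem t2Space_maximalIdealSpace [T2Space K] : T2Space (MaximalIdealSpace K A) where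
  t2 := fun M N hMN => by
    obtain ⟨s, rfl⟩ := (hΨ.toMaximalIdealSpace_bijective G).2 M
    obtain ⟨t, rfl⟩ := (hΨ.toMaximalIdealSpace_bijective G).2 N
    have h : ∃ x : A, Ψ x s ≠ Ψ x t := by
      by_contra! h
      refine hMN (Subtype.ext (AddSubgroup.ext fun x => ?_))
      change Ψ x s = 0 ↔ Ψ x t = 0
      rw [h]
    obtain ⟨x, hx⟩ := h
    refine separated_by_continuous (continuous_gelfandValue x) ?_
    rwa [hΨ.gelfandValue_toMaximalIdealSpace G, hΨ.gelfandValue_toMaximalIdealSpace G]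

/-- A compact Hausdorff space `X` is homeomorphic to the spectrum of `C(X, K)`. -/
def homeomorphMaximalIdealSpace [T2Space K] : X ≃ₜ MaximalIdealSpace K A :=
  haveI := hΨ.t2Space_maximalIdealSpace G
  Continuous.homeoOfEquivCompactToT2
    (f := Equiv.ofBijective _ (hΨ.toMaximalIdealSpace_bijective G))
    (hΨ.continuous_toMaximalIdealSpace G)

end IsIsometricStarIsomorphism

/-- Gelfand duality for quasicommutative C*-algebras, for any `K` with a generator system. -/
theorem IsQuasicommutativeCStarAlgebra.gelfand_duality.{u} {K : Type*} [NonAssocRing K]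
    [Module ℝ K] [Norm K] [Star K] [TopologicalSpace K] [ContinuousAdd K] [ContinuousSMul ℝ K]
    [T2Space K] {ι : Type*} [Fintype ι] [DecidableEq ι] {i : ι → K} {o j : ι}
    {coord : ι → K →ₗ[ℝ] ℝ} (G : IsGeneratorSystem i o j coord) {A : Type u}
    [NonAssocUnitalNormedRing A] [NormedSpace ℝ A] [SMul K A] [SMul Kᵐᵒᵖ A] [Star A]
    (hA : IsQuasicommutativeCStarAlgebra i A) :
    (∀ (M : MaximalIdealSpace K A) (x : A), ∃! c : K, x - c • (1 : A) ∈ M.1) ∧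
      CompactSpace (MaximalIdealSpace K A) ∧ T2Space (MaximalIdealSpace K A) ∧
      ∃ Φ : A ≃ C(MaximalIdealSpace K A, K),
        IsIsometricStarIsomorphism Φ ∧ ∀ x M, Φ x M = gelfandValue M x := by
  obtain ⟨X, _, _, _, Ψ, hΨ⟩ := hA.exists_equiv_continuousMap G
  let h := hΨ.homeomorphMaximalIdealSpace G
  refine ⟨fun M x => ?_, h.compactSpace, hΨ.t2Space_maximalIdealSpace G, _, hΨ.arrowCongr h,
    fun x M => ?_⟩
  · obtain ⟨t, rfl⟩ := h.surjective M
    exact ⟨Ψ x t, (hΨ.sub_smul_one_mem_toMaximalIdealSpace G).2 rfl,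
      fun c hc => ((hΨ.sub_smul_one_mem_toMaximalIdealSpace G).1 hc).symm⟩
  · obtain ⟨t, rfl⟩ := h.surjective M
    change Ψ x (h.symm (h t)) = gelfandValue (hΨ.toMaximalIdealSpace G t) x
    rw [h.symm_apply_apply, hΨ.gelfandValue_toMaximalIdealSpace G]

end

theorem theorem2p22 :
    (∀ (A : Type*) [NonAssocUnitalNormedRing A] [NormedSpace ℝ A]
        [SMul ℍ[ℝ] A] [SMul (ℍ[ℝ])ᵐᵒᵖ A] [Star A],
      IsQuasicommutativeCStarAlgebra quaternionGenerators A →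
        (∀ (M : MaximalIdealSpace ℍ[ℝ] A) (x : A), ∃! c : ℍ[ℝ], x - c • (1 : A) ∈ M.1) ∧
        CompactSpace (MaximalIdealSpace ℍ[ℝ] A) ∧ T2Space (MaximalIdealSpace ℍ[ℝ] A) ∧
        ∃ Φ : A ≃ C(MaximalIdealSpace ℍ[ℝ] A, ℍ[ℝ]),
          IsIsometricStarIsomorphism Φ ∧ ∀ x M, Φ x M = gelfandValue M x) ∧
    (∀ (A : Type*) [NonAssocUnitalNormedRing A] [NormedSpace ℝ A]
        [SMul Octonion A] [SMul Octonionᵐᵒᵖ A] [Star A],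
      IsQuasicommutativeCStarAlgebra octonionGenerators A →
        (∀ (M : MaximalIdealSpace Octonion A) (x : A), ∃! c : Octonion, x - c • (1 : A) ∈ M.1) ∧
        CompactSpace (MaximalIdealSpace Octonion A) ∧ T2Space (MaximalIdealSpace Octonion A) ∧
        ∃ Φ : A ≃ C(MaximalIdealSpace Octonion A, Octonion),
          IsIsometricStarIsomorphism Φ ∧ ∀ x M, Φ x M = gelfandValue M x) := by
  exact ⟨fun _ _ _ _ _ _ hA => hA.gelfand_duality quaternion_isGeneratorSystem,
    fun _ _ _ _ _ _ hA => hA.gelfand_duality octonion_isGeneratorSystem⟩
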